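/- Let $(X,d)$ be an arbitrary metric space, let $p\in[1,\infty]$, let $a\le b$ be real numbers, and let $\gamma:[a,b]\to X$ be any map. For a metric space $(Y,\rho)$, let $AC_p([a,b],Y)$ denote the set of all $p$-absolutely continuous maps, i.e. of all maps $f:[a,b]\to Y$ for which there is a nonnegative Borel function $g\in L_p([a,b])$ (with respect to Lebesgue measure) such that $$\rho(f(t_1),f(t_2))\le\int_{t_1}^{t_2}g(\tau)\,d\tau\qquad\text{for all } a\le t_1\le t_2\le b,$$ and write $AC_p([a,b])$ for $AC_p([a,b],\mathbb{R})$ with the usual metric on $\mathbb{R}$. Then $$\gamma\in AC_p([a,b],X)\quad\Longleftrightarrow\quad h\circ\gamma\in AC_p([a,b])\ \text{ for every Lipschitz function } h:X\to\mathbb{R}.$$ -/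

import Mathlib

open scoped NNReal ENNReal

/-- The space `LIP(X)` of all Lipschitz functions `h : X → ℝ`. -/
def LIP (X : Type*) [MetricSpace X] : Set (X → ℝ) :=
  {h | ∃ L : ℝ≥0, LipschitzWith L h}

/-- The space `AC_p([a,b],Y)` of all `p`-absolutely continuous maps `γ : [a,b] → Y`: there is a
nonnegative Borel function `g` on `[a,b]` lying in `L_p([a,b])` (Lebesgue measure on `[a,b]`)
such that `d(γ(t₁),γ(t₂)) ≤ ∫_{t₁}^{t₂} g` for all `a ≤ t₁ ≤ t₂ ≤ b`.
The function `g` is written as a Borel function on `ℝ` of which only the values on `[a,b]` are used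
(every Borel function on `[a,b]` is such a restriction, e.g. of its extension by zero).
For `1 ≤ p` membership in `L_p([a,b])` makes `g` integrable on `[a,b]`. -/
def AC (p : ℝ≥0∞) (a b : ℝ) (Y : Type*) [MetricSpace Y] : Set (Set.Icc a b → Y) :=
  {γ | ∃ g : ℝ → ℝ, Measurable g ∧ (∀ t ∈ Set.Icc a b, 0 ≤ g t) ∧
      MeasureTheory.MemLp g p (MeasureTheory.volume.restrict (Set.Icc a b)) ∧
      ∀ t₁ t₂ : Set.Icc a b, t₁ ≤ t₂ →
        dist (γ t₁) (γ t₂) ≤ ∫ t in (t₁ : ℝ)..(t₂ : ℝ), g t}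

open MeasureTheory Set Filter Topology

/-! Only the implication from Lipschitz compositions back to γ is hard. The natural majorant is the
supremum of |(h ∘ γ)'| over the distance functions h to a countable dense set of points of the
image; each of these derivatives is in L_p, and the issue is to show that the supremum is too.

The closed graph theorem, applied to ℓ¹-combinations of 1-Lipschitz functions, bounds the L_p norm
of (h ∘ γ)' by one constant C for all 1-Lipschitz h (`LipACOn.exists_eLpNorm_le`).

For finitely many h_i, split the times according to which derivative dominates. A point visited from
two different pieces is a transversal self-intersection of the planar curve (h_i ∘ γ, h_j ∘ γ), and
these are countable, so off a countable set the pieces have disjoint images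
(`countable_crossing_dominantTimes`). On compact subsets of the pieces the images lie at positive
distance, so the small oscillations s·sin(h_i/s) and s·cos(h_i/s) glue to two 1-Lipschitz functions.
Since |sin| + |cos| ≥ 1, their derivatives together dominate the maximum, whose norm is thus at most
2C however many h_i there are. Fatou's lemma then handles a sequence. -/

/-! ### Derivatives of absolutely continuous functions -/

/-- A map dominated by an absolutely continuous one is absolutely continuous. -/
theorem AbsolutelyContinuousOnInterval.of_dist_le {f g : ℝ → ℝ} {a b : ℝ}
    (hg : AbsolutelyContinuousOnInterval g a b)
    (h : ∀ s ∈ uIcc a b, ∀ t ∈ uIcc a b, dist (f s) (f t) ≤ dist (g s) (g t)) :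
    AbsolutelyContinuousOnInterval f a b := by
  rw [absolutelyContinuousOnInterval_iff] at hg ⊢
  intro ε hε
  obtain ⟨δ, hδ, H⟩ := hg ε hε
  refine ⟨δ, hδ, fun E hE hlen => lt_of_le_of_lt (Finset.sum_le_sum fun i hi => ?_) (H E hE hlen)⟩
  exact h _ (hE.1 i hi).1 _ (hE.1 i hi).2

theorem HasDerivAt.norm_le_of_dist_le {f g : ℝ → ℝ} {f' g' x : ℝ} (hf : HasDerivAt f f' x)
    (hg : HasDerivAt g g' x) (h : ∀ᶠ y in 𝓝 x, dist (f y) (f x) ≤ dist (g y) (g x)) :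
    ‖f'‖ ≤ ‖g'‖ := by
  rw [hasDerivAt_iff_tendsto_slope] at hf hg
  refine le_of_tendsto_of_tendsto hf.norm hg.norm (h.filter_mono nhdsWithin_le_nhds |>.mono ?_)
  intro y hy
  simp only [slope, vsub_eq_sub, norm_smul, dist_eq_norm] at hy ⊢
  exact mul_le_mul_of_nonneg_left hy (norm_nonneg _)

/-- The increments of `f` are dominated by those of the indefinite integral of `g`. This transfers
absolute continuity and, by Lebesgue differentiation, gives |f'| ≤ |g| almost everywhere. -/
theorem AC.absolutelyContinuousOnInterval_and_memLp_deriv {p : ℝ≥0∞} (hp : 1 ≤ p) {a b : ℝ}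
    (hab : a ≤ b) {f : Icc a b → ℝ} (hf : f ∈ AC p a b ℝ) :
    AbsolutelyContinuousOnInterval (IccExtend hab f) a b ∧
      MemLp (deriv (IccExtend hab f)) p (volume.restrict (Icc a b)) := by
  obtain ⟨g, hgm, hg0, hgp, hfg⟩ := hf
  have hgi : IntervalIntegrable g volume a b := by
    rw [intervalIntegrable_iff_integrableOn_Icc_of_le hab]
    exact hgp.integrable hp
  have hI := hgi.absolutelyContinuousOnInterval_intervalIntegral (c := a) (by simp)
  have hsub : ∀ s ∈ Icc a b, ∀ t ∈ Icc a b, IntervalIntegrable g volume s t := fun s hs t ht =>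
    hgi.mono_set (by rw [uIcc_of_le hab]; exact uIcc_subset_Icc hs ht)
  have key : ∀ s ∈ Icc a b, ∀ t ∈ Icc a b, dist (IccExtend hab f s) (IccExtend hab f t) ≤
      dist (∫ x in a..s, g x) (∫ x in a..t, g x) := by
    intro s hs t ht
    wlog hst : s ≤ t generalizing s t
    · rw [dist_comm, dist_comm (∫ x in a..s, g x)]
      exact this t ht s hs (le_of_not_ge hst)
    rw [IccExtend_of_mem _ _ hs, IccExtend_of_mem _ _ ht, dist_comm (∫ x in a..s, g x),
      Real.dist_eq (∫ x in a..t, g x), intervalIntegral.integral_interval_sub_left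
        (hsub a (by simp [hab]) t ht) (hsub a (by simp [hab]) s hs)]
    exact (hfg ⟨s, hs⟩ ⟨t, ht⟩ hst).trans (le_abs_self _)
  have hac : AbsolutelyContinuousOnInterval (IccExtend hab f) a b :=
    hI.of_dist_le (by rwa [uIcc_of_le hab])
  refine ⟨hac, hgp.mono (measurable_deriv _).aestronglyMeasurable ?_⟩
  rw [← Measure.restrict_congr_set Ioo_ae_eq_Icc, ae_restrict_iff' measurableSet_Ioo]
  filter_upwards [hac.ae_differentiableAt, hgi.ae_hasDerivAt_integral] with x h1 h2 hx
  rw [uIcc_of_le hab] at h1 h2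
  have hx' := Ioo_subset_Icc_self hx
  refine (h1 hx').hasDerivAt.norm_le_of_dist_le (h2 hx' a (by simp [hab])) ?_
  filter_upwards [Icc_mem_nhds hx.1 hx.2] with y hy using key y hy x hx'

/-! ### Closed graph argument -/

theorem exists_eLpNorm_one_le {α : Type*} [MeasurableSpace α] (μ : Measure α) [IsFiniteMeasure μ]
    {p : ℝ≥0∞} (hp : 1 ≤ p) : ∃ D : ℝ≥0, ∀ f : α → ℝ, AEStronglyMeasurable f μ →
      eLpNorm f 1 μ ≤ eLpNorm f p μ * D := by
  -- For `p = ⊤`, `p.toReal` is 0 and division by it gives 0, so the exponent is 1, as it should be.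
  have h : μ univ ^ (1 / (1 : ℝ≥0∞).toReal - 1 / p.toReal) ≠ ⊤ := by
    refine (ENNReal.rpow_lt_top_of_nonneg ?_ (measure_ne_top _ _)).ne
    rcases eq_or_ne p ⊤ with rfl | hpt
    · simp
    · have : 1 ≤ p.toReal := by simpa using (ENNReal.toReal_le_toReal (by simp) hpt).2 hp
      simpa using inv_le_one_of_one_le₀ this
  lift μ univ ^ (1 / (1 : ℝ≥0∞).toReal - 1 / p.toReal) to ℝ≥0 using h with D hD
  exact ⟨D, fun f hf => by rw [hD]; exact eLpNorm_le_eLpNorm_mul_rpow_measure_univ hp hf⟩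

/-- The closed graph theorem for families of absolutely continuous functions. -/
theorem exists_eLpNorm_deriv_le {E : Type*} [NormedAddCommGroup E] [NormedSpace ℝ E]
    [CompleteSpace E] {p : ℝ≥0∞} (hp : 1 ≤ p) {a b : ℝ} (hab : a ≤ b) (S : E →ₗ[ℝ] (ℝ → ℝ))
    (hac : ∀ c, AbsolutelyContinuousOnInterval (S c) a b)
    (hmem : ∀ c, MemLp (deriv (S c)) p (volume.restrict (Icc a b)))
    (hcont : ∀ t, Continuous fun c => S c t) :
    ∃ C : ℝ≥0, ∀ c, eLpNorm (deriv (S c)) p (volume.restrict (Icc a b)) ≤ C * ‖c‖ₑ := by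
  have : Fact (1 ≤ p) := ⟨hp⟩
  have hdiff : ∀ c, ∀ᵐ x ∂(volume.restrict (Icc a b)), DifferentiableAt ℝ (S c) x := by
    intro c
    rw [ae_restrict_iff' measurableSet_Icc]
    filter_upwards [(hac c).ae_differentiableAt] with x hx
    rwa [uIcc_of_le hab] at hx
  let T : E →ₗ[ℝ] Lp ℝ p (volume.restrict (Icc a b)) :=
    { toFun := fun c => (hmem c).toLp _
      map_add' := by
        intro c d
        rw [← MemLp.toLp_add, MemLp.toLp_eq_toLp_iff]
        filter_upwards [hdiff c, hdiff d] with x h1 h2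
        rw [map_add, deriv_add h1 h2, Pi.add_apply]
      map_smul' := by
        intro r c
        rw [RingHom.id_apply, ← MemLp.toLp_const_smul, MemLp.toLp_eq_toLp_iff]
        filter_upwards [hdiff c] with x h1
        rw [map_smul, deriv_const_smul _ h1, Pi.smul_apply] }
  have hTc : ∀ c, ⇑(T c) =ᵐ[volume.restrict (Icc a b)] deriv (S c) := fun c => (hmem c).coeFn_toLp
  have hTcont : Continuous T := by
    -- Pointwise convergence of `S (u n)` and L_p convergence of the derivatives force `y` and `T c`
    -- to have the same integral over every [a,t]; Lebesgue differentiation then identifies them.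
    refine T.continuous_of_seq_closed_graph fun u c y hu hTu => ?_
    have hint : ∀ t ∈ Icc a b, ∀ w : Lp ℝ p (volume.restrict (Icc a b)),
        IntegrableOn w (Ioc a t) := fun t ht w =>
      IntegrableOn.mono_set (t := Icc a b) ((Lp.memLp w).integrable hp)
        (Ioc_subset_Icc_self.trans (Icc_subset_Icc_right ht.2))
    have hFTC : ∀ c, ∀ t ∈ Icc a b, ∫ x in Ioc a t, T c x = S c t - S c a := by
      intro c t ht
      have h1 := ((hac c).mono (c := a) (d := t) (by
        rw [uIcc_of_le hab, uIcc_of_le ht.1]; exact Icc_subset_Icc_right ht.2)).integral_deriv_eq_sub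
      rw [← h1, intervalIntegral.integral_of_le ht.1]
      refine integral_congr_ae (ae_restrict_of_ae_restrict_of_subset
        (Ioc_subset_Icc_self.trans (Icc_subset_Icc_right ht.2)) (hTc c))
    have hlim : ∀ t ∈ Icc a b, ∫ x in Ioc a t, y x = ∫ x in Ioc a t, T c x := by
      intro t ht
      have h1 : Tendsto (fun n => ∫ x in Ioc a t, T (u n) x) atTop (𝓝 (∫ x in Ioc a t, T c x)) := by
        rw [hFTC c t ht]
        simp_rw [hFTC _ t ht]
        exact (((hcont t).tendsto c).comp hu).sub (((hcont a).tendsto c).comp hu)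
      have h2 : Tendsto (fun n => ∫ x in Ioc a t, T (u n) x) atTop (𝓝 (∫ x in Ioc a t, y x)) := by
        have h3 : Tendsto (fun n => eLpNorm (⇑(T (u n)) - ⇑y) 1 (volume.restrict (Icc a b)))
            atTop (𝓝 0) := by
          have h4 := (Lp.tendsto_Lp_iff_tendsto_eLpNorm' _ _).1 hTu
          obtain ⟨D, hD⟩ := exists_eLpNorm_one_le (volume.restrict (Icc a b)) hp
          have h5 := ENNReal.Tendsto.mul_const (b := D) h4 (Or.inr ENNReal.coe_ne_top)
          rw [zero_mul] at h5
          refine tendsto_of_tendsto_of_tendsto_of_le_of_le tendsto_const_nhds h5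
            (fun _ => zero_le) fun n => ?_
          exact hD _ ((Lp.aestronglyMeasurable _).sub (Lp.aestronglyMeasurable _))
        refine tendsto_integral_of_L1' _ (hint t ht y).aestronglyMeasurable
          (Eventually.of_forall fun n => hint t ht _) ?_
        refine tendsto_of_tendsto_of_tendsto_of_le_of_le tendsto_const_nhds h3
            (fun _ => zero_le) fun n => eLpNorm_mono_measure _ (Measure.restrict_mono
              (Ioc_subset_Icc_self.trans (Icc_subset_Icc_right ht.2)) le_rfl)
      exact tendsto_nhds_unique h2 h1
    apply Lp.ext
    have hii : ∀ w : Lp ℝ p (volume.restrict (Icc a b)), IntervalIntegrable w volume a b :=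
      fun w => (intervalIntegrable_iff_integrableOn_Icc_of_le hab).2 ((Lp.memLp w).integrable hp)
    change ∀ᵐ x ∂(volume.restrict (Icc a b)), y x = T c x
    -- The types of `y` and `T c` mention the restricted measure; hiding the predicate keeps the
    -- rewrite from touching them.
    generalize hyT : (fun x => y x = T c x) = P
    rw [← Measure.restrict_congr_set Ioo_ae_eq_Icc, ae_restrict_iff' measurableSet_Ioo, ← hyT]
    filter_upwards [(hii y).ae_hasDerivAt_integral, (hii (T c)).ae_hasDerivAt_integral]
      with x h1 h2 hx
    rw [uIcc_of_le hab] at h1 h2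
    have hx' := Ioo_subset_Icc_self hx
    refine (h1 hx' a (by simp [hab])).unique ((h2 hx' a (by simp [hab])).congr_of_eventuallyEq ?_)
    filter_upwards [Icc_mem_nhds hx.1 hx.2] with t ht
    rw [intervalIntegral.integral_of_le ht.1, intervalIntegral.integral_of_le ht.1, hlim t ht]
  let T' : E →L[ℝ] Lp ℝ p (volume.restrict (Icc a b)) := ⟨T, hTcont⟩
  refine ⟨‖T'‖₊, fun c => ?_⟩
  have h := T'.le_opNNNorm c
  have h2 : eLpNorm (deriv (S c)) p (volume.restrict (Icc a b)) = ‖T' c‖ₑ := by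
    rw [Lp.enorm_def]
    exact (eLpNorm_congr_ae (hTc c)).symm
  rw [h2]
  simp only [enorm_eq_nnnorm]
  exact_mod_cast h

/-! ### Uniform bound over 1-Lipschitz functions -/

section

/-- `Γ` is absolutely continuous with derivative in `L_p` after composition with Lipschitz
functions. -/
def LipACOn {X : Type*} [MetricSpace X] (p : ℝ≥0∞) (a b : ℝ) (Γ : ℝ → X) : Prop :=
  ∀ h ∈ LIP X, AbsolutelyContinuousOnInterval (h ∘ Γ) a b ∧
    MemLp (deriv (h ∘ Γ)) p (volume.restrict (Icc a b))


variable {X : Type*} [MetricSpace X]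

theorem summable_mul_of_lipschitzWith_one {f : ℕ → X → ℝ} (hf : ∀ n, LipschitzWith 1 (f n))
    (c : lp (fun _ : ℕ => ℝ) 1) (x y : X) : Summable fun n => c n * (f n x - f n y) := by
  have hc : Summable fun n => ‖c n‖ := by simpa using (lp.memℓp c).summable (by simp)
  refine Summable.of_norm_bounded (hc.mul_right (dist x y)) fun n => ?_
  rw [norm_mul, ← dist_eq_norm (f n x)]
  exact mul_le_mul_of_nonneg_left (by simpa using (hf n).dist_le_mul x y) (norm_nonneg _)

theorem norm_tsum_mul_le_of_lipschitzWith_one {f : ℕ → X → ℝ} (hf : ∀ n, LipschitzWith 1 (f n))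
    (c : lp (fun _ : ℕ => ℝ) 1) (x y : X) :
    ‖∑' n, c n * (f n x - f n y)‖ ≤ ‖c‖ * dist x y := by
  have hc : Summable fun n => ‖c n‖ := by simpa using (lp.memℓp c).summable (by simp)
  have h : ‖c‖ = ∑' n, ‖c n‖ := by simpa using lp.norm_eq_tsum_rpow (by simp) c
  rw [h, ← tsum_mul_right]
  refine tsum_of_norm_bounded (hc.mul_right (dist x y)).hasSum fun n => ?_
  rw [norm_mul, ← dist_eq_norm (f n x)]
  exact mul_le_mul_of_nonneg_left (by simpa using (hf n).dist_le_mul x y) (norm_nonneg _)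

/-- Otherwise some 1-Lipschitz `f n` has norm above `n` for each `n`. All ℓ¹-combinations of the `f
n` are Lipschitz, so the closed graph bound applies, and the unit vectors of ℓ¹ contradict it. -/
theorem LipACOn.exists_eLpNorm_le {p : ℝ≥0∞} (hp : 1 ≤ p) {a b : ℝ} (hab : a ≤ b) {Γ : ℝ → X}
    (H : LipACOn p a b Γ) : ∃ C : ℝ≥0, ∀ h : X → ℝ, LipschitzWith 1 h →
      eLpNorm (deriv (h ∘ Γ)) p (volume.restrict (Icc a b)) ≤ C := by
  by_contra! hcon
  choose f hf hfn using fun n : ℕ => hcon n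
  -- Subtracting the value at `Γ a` makes the series converge, as the `f n` need not be bounded in
  -- `n`; derivatives are unaffected.
  let S : lp (fun _ : ℕ => ℝ) 1 →ₗ[ℝ] (ℝ → ℝ) :=
    { toFun := fun c t => ∑' n, c n * (f n (Γ t) - f n (Γ a))
      map_add' := by
        intro c d
        ext t
        simp only [Pi.add_apply, lp.coeFn_add, add_mul]
        exact (summable_mul_of_lipschitzWith_one hf c _ _).tsum_add
          (summable_mul_of_lipschitzWith_one hf d _ _)
      map_smul' := by
        intro r c
        ext t
        simp [mul_assoc, tsum_mul_left] }
  have hS : ∀ c, ∃ h ∈ LIP X, S c = h ∘ Γ := by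
    intro c
    refine ⟨fun x => ∑' n, c n * (f n x - f n (Γ a)), ⟨‖c‖₊, ?_⟩, rfl⟩
    refine LipschitzWith.of_dist_le_mul fun x y => ?_
    rw [dist_eq_norm, ← (summable_mul_of_lipschitzWith_one hf c _ _).tsum_sub
      (summable_mul_of_lipschitzWith_one hf c _ _)]
    simp_rw [← mul_sub, sub_sub_sub_cancel_right]
    exact norm_tsum_mul_le_of_lipschitzWith_one hf c x y
  have hcont : ∀ t, Continuous fun c => S c t := by
    intro t
    exact AddMonoidHomClass.continuous_of_bound ((LinearMap.proj t).comp S) (dist (Γ t) (Γ a))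
      fun c => (norm_tsum_mul_le_of_lipschitzWith_one hf c (Γ t) (Γ a)).trans_eq (mul_comm _ _)
  obtain ⟨C, hC⟩ := exists_eLpNorm_deriv_le hp hab S
    (fun c => by obtain ⟨h, hh, he⟩ := hS c; rw [he]; exact (H h hh).1)
    (fun c => by obtain ⟨h, hh, he⟩ := hS c; rw [he]; exact (H h hh).2) hcont
  obtain ⟨n, hn⟩ := exists_nat_ge C
  have h1 := hC (lp.single 1 n (1 : ℝ))
  have h2 : S (lp.single 1 n (1 : ℝ)) = fun t => (f n ∘ Γ) t - f n (Γ a) := by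
    ext t
    change ∑' k, (lp.single 1 n (1 : ℝ) : lp (fun _ : ℕ => ℝ) 1) k * (f k (Γ t) - f k (Γ a)) = _
    rw [tsum_eq_single n]
    · simp
    · intro k hk
      simp [hk]
  have h3 : ‖lp.single (E := fun _ : ℕ => ℝ) 1 n (1 : ℝ)‖ₑ = 1 := by
    rw [← ofReal_norm, lp.norm_single (by simp)]
    simp
  have h4 : deriv (fun t => (f n ∘ Γ) t - f n (Γ a)) = deriv (f n ∘ Γ) := by
    ext t
    rw [deriv_sub_const_fun]
  rw [h2, h3, h4, mul_one] at h1
  exact absurd (hfn n) (not_lt.2 (h1.trans (by exact_mod_cast hn)))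

/-! ### Countable exceptional sets -/

theorem Set.countable_of_forall_eventually_notMem {α : Type*} [TopologicalSpace α]
    [SecondCountableTopology α] {A : Set α} (h : ∀ x ∈ A, ∀ᶠ y in 𝓝[≠] x, y ∉ A) :
    A.Countable := by
  have : DiscreteTopology A := by
    rw [discreteTopology_subtype_iff]
    intro x hx
    rw [inf_principal_eq_bot]
    exact h x hx
  exact TopologicalSpace.separableSpace_iff_countable.1
    (inferInstance : TopologicalSpace.SeparableSpace A)

/-- Transversal self-intersections of a planar curve are countable. -/
theorem countable_transversal_pairs (u v : ℝ → ℝ) :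
    {q : ℝ × ℝ | u q.1 = u q.2 ∧ v q.1 = v q.2 ∧
      DifferentiableAt ℝ u q.1 ∧ DifferentiableAt ℝ u q.2 ∧
      DifferentiableAt ℝ v q.1 ∧ DifferentiableAt ℝ v q.2 ∧
      deriv u q.1 * deriv v q.2 ≠ deriv v q.1 * deriv u q.2}.Countable := by
  refine Set.countable_of_forall_eventually_notMem ?_
  rintro ⟨t, s⟩ ⟨-, -, hut, hus, hvt, hvs, hdet⟩
  dsimp only at hut hus hvt hvs hdet
  have hu : HasFDerivAt (fun q : ℝ × ℝ => u q.1 - u q.2)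
      ((deriv u t) • ContinuousLinearMap.fst ℝ ℝ ℝ - (deriv u s) • ContinuousLinearMap.snd ℝ ℝ ℝ)
      (t, s) :=
    (HasDerivAt.comp_hasFDerivAt (t, s) (f := Prod.fst) hut.hasDerivAt hasFDerivAt_fst).sub
      (HasDerivAt.comp_hasFDerivAt (t, s) (f := Prod.snd) hus.hasDerivAt hasFDerivAt_snd)
  have hv : HasFDerivAt (fun q : ℝ × ℝ => v q.1 - v q.2)
      ((deriv v t) • ContinuousLinearMap.fst ℝ ℝ ℝ - (deriv v s) • ContinuousLinearMap.snd ℝ ℝ ℝ)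
      (t, s) :=
    (HasDerivAt.comp_hasFDerivAt (t, s) (f := Prod.fst) hvt.hasDerivAt hasFDerivAt_fst).sub
      (HasDerivAt.comp_hasFDerivAt (t, s) (f := Prod.snd) hvs.hasDerivAt hasFDerivAt_snd)
  -- The determinant condition makes this derivative injective, so the zero of the difference map is
  -- isolated.
  have huv := hu.prodMk hv
  refine (huv.eventually_ne (c := (0, 0)) ?_).mono ?_
  · obtain ⟨C, -, hC⟩ := LinearMap.exists_antilipschitzWith
      (((deriv u t • ContinuousLinearMap.fst ℝ ℝ ℝ - deriv u s • ContinuousLinearMap.snd ℝ ℝ ℝ).prod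
      (deriv v t • ContinuousLinearMap.fst ℝ ℝ ℝ - deriv v s • ContinuousLinearMap.snd ℝ ℝ ℝ) :
        ℝ × ℝ →L[ℝ] ℝ × ℝ) : ℝ × ℝ →ₗ[ℝ] ℝ × ℝ) (by
        rw [LinearMap.ker_eq_bot']
        rintro ⟨x, y⟩ hxy
        simp only [ContinuousLinearMap.coe_coe, ContinuousLinearMap.prod_apply,
          sub_apply, smul_apply,
          ContinuousLinearMap.coe_fst', ContinuousLinearMap.coe_snd', smul_eq_mul,
          Prod.mk_eq_zero] at hxy
        obtain ⟨h1, h2⟩ := hxy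
        have hd : deriv u t * deriv v s - deriv v t * deriv u s ≠ 0 := sub_ne_zero.2 hdet
        have hx : x = 0 := by
          refine (mul_eq_zero.1 (?_ : (deriv u t * deriv v s - deriv v t * deriv u s) * x = 0))
            |>.resolve_left hd
          linear_combination deriv v s * h1 - deriv u s * h2
        have hy : y = 0 := by
          refine (mul_eq_zero.1 (?_ : (deriv u t * deriv v s - deriv v t * deriv u s) * y = 0))
            |>.resolve_left hd
          linear_combination deriv v t * h1 - deriv u t * h2
        simp [hx, hy])
    exact ⟨C, hC⟩
  · rintro q hq ⟨h1, h2, -⟩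
    exact hq (by simp [h1, h2])

/-- Two functions that agree on a set have equal derivatives almost everywhere on it. -/
theorem ae_deriv_eq_of_eqOn {f g : ℝ → ℝ} {K : Set ℝ} (h : EqOn f g K) :
    ∀ᵐ t, t ∈ K → DifferentiableAt ℝ f t → DifferentiableAt ℝ g t → deriv f t = deriv g t := by
  -- Isolated points of `K` are countable, hence null; at accumulation points the derivative is
  -- determined by the values on `K`.
  have hc : {t | t ∈ K ∧ ¬ AccPt t (𝓟 K)}.Countable := by
    refine Set.countable_of_forall_eventually_notMem ?_
    rintro x ⟨-, hx⟩
    rw [accPt_iff_frequently_nhdsNE, not_frequently] at hx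
    exact hx.mono fun y hy hyA => hy hyA.1
  filter_upwards [measure_eq_zero_iff_ae_notMem.1 (hc.measure_zero volume)] with t ht htK hf hg
  have hacc : AccPt t (𝓟 K) := by_contra fun hn => ht ⟨htK, hn⟩
  have hu := uniqueDiffWithinAt_iff_accPt.2 hacc
  rw [← hf.derivWithin hu, ← hg.derivWithin hu]
  exact derivWithin_congr h (h htK)


/-! ### Gluing Lipschitz functions -/

theorem exists_pos_le_dist_of_pairwise_disjoint {ι : Type*} [Finite ι] {Z : ι → Set X}
    (hZ : ∀ i, IsCompact (Z i)) (hd : Pairwise fun i j => Disjoint (Z i) (Z j)) :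
    ∃ δ > (0 : ℝ), ∀ i j, i ≠ j → ∀ x ∈ Z i, ∀ y ∈ Z j, δ ≤ dist x y := by
  have h : ∀ᶠ δ in 𝓝[>] (0 : ℝ), ∀ i j, i ≠ j → ∀ x ∈ Z i, ∀ y ∈ Z j, δ ≤ dist x y := by
    rw [eventually_all]
    intro i
    rw [eventually_all]
    intro j
    by_cases hij : i = j
    · simp [hij]
    obtain ⟨r, hr, h⟩ := Metric.exists_pos_forall_lt_edist (hZ i) (hZ j).isClosed (hd hij)
    filter_upwards [Ioo_mem_nhdsGT (show (0 : ℝ) < r from hr)] with δ hδ _ x hx y hy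
    have h1 := h x hx y hy
    rw [edist_nndist, ENNReal.coe_lt_coe] at h1
    exact hδ.2.le.trans (by rw [dist_nndist]; exact_mod_cast h1.le)
  obtain ⟨δ, h1, h2⟩ := (h.and self_mem_nhdsWithin).exists
  exact ⟨δ, h2, h1⟩

/-- Rescaled copies of a bounded Lipschitz function composed with different Lipschitz functions on
finitely many disjoint compact sets glue to a Lipschitz function. -/
theorem exists_lipschitzWith_one_glue {ι : Type*} [Finite ι] {Z : ι → Set X}
    (hZ : ∀ i, IsCompact (Z i)) (hd : Pairwise fun i j => Disjoint (Z i) (Z j))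
    {h : ι → X → ℝ} (hh : ∀ i, LipschitzWith 1 (h i)) :
    ∃ s > (0 : ℝ), ∀ φ : ℝ → ℝ, LipschitzWith 1 φ → (∀ y, |φ y| ≤ 1) →
      ∃ F : X → ℝ, LipschitzWith 1 F ∧ ∀ i, ∀ x ∈ Z i, F x = s * φ (h i x / s) := by
  obtain ⟨δ, hδ, H⟩ := exists_pos_le_dist_of_pairwise_disjoint hZ hd
  -- Values of s·φ lie in [-s, s], so they differ by at most 2s = δ, the separation of distinct
  -- pieces.
  refine ⟨δ / 2, half_pos hδ, fun φ hφ hφ1 => ?_⟩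
  classical
  have hs : 0 < δ / 2 := half_pos hδ
  obtain ⟨s, hsδ⟩ : ∃ s, s = δ / 2 := ⟨_, rfl⟩
  rw [← hsδ] at hs ⊢
  let G : X → ℝ := fun x =>
    if hx : ∃ i, x ∈ Z i then s * φ (h hx.choose x / s) else 0
  have hG : ∀ i, ∀ x ∈ Z i, G x = s * φ (h i x / s) := by
    intro i x hx
    have hex : ∃ i, x ∈ Z i := ⟨i, hx⟩
    have : hex.choose = i := by
      by_contra hne
      exact (hd hne).le_bot ⟨hex.choose_spec, hx⟩
    simp only [G, dif_pos hex, this]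
  have hGL : LipschitzOnWith 1 G (⋃ i, Z i) := by
    refine LipschitzOnWith.of_dist_le_mul fun x hx y hy => ?_
    obtain ⟨i, hi⟩ := mem_iUnion.1 hx
    obtain ⟨j, hj⟩ := mem_iUnion.1 hy
    rw [hG i x hi, hG j y hj, NNReal.coe_one, one_mul, Real.dist_eq, ← mul_sub, abs_mul,
      abs_of_pos hs]
    by_cases hij : i = j
    · subst hij
      have h1 : |φ (h i x / s) - φ (h i y / s)| ≤ |h i x / s - h i y / s| := by
        simpa [Real.dist_eq] using hφ.dist_le_mul (h i x / s) (h i y / s)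
      have h2 : |h i x - h i y| ≤ dist x y := by
        simpa [Real.dist_eq] using (hh i).dist_le_mul x y
      rw [← sub_div, abs_div, abs_of_pos hs] at h1
      calc s * |φ (h i x / s) - φ (h i y / s)| ≤ s * (|h i x - h i y| / s) := by gcongr
        _ = |h i x - h i y| := by field_simp
        _ ≤ dist x y := h2
    · have h1 : |φ (h i x / s) - φ (h j y / s)| ≤ 2 := by
        linarith [abs_sub (φ (h i x / s)) (φ (h j y / s)), hφ1 (h i x / s), hφ1 (h j y / s)]
      calc s * |φ (h i x / s) - φ (h j y / s)| ≤ s * 2 := by gcongr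
        _ = δ := by rw [hsδ]; ring
        _ ≤ dist x y := H i j hij x hi y hj
  obtain ⟨F, hF, hFG⟩ := hGL.extend_real
  exact ⟨F, hF, fun i x hx => by rw [← hFG (mem_iUnion.2 ⟨i, hx⟩), hG i x hx]⟩

theorem measurable_nnreal_finset_sup {α ι : Type*} [MeasurableSpace α] (s : Finset ι)
    {f : ι → α → ℝ≥0} (hf : ∀ i ∈ s, Measurable (f i)) :
    Measurable fun x => s.sup fun i => f i x := by
  classical
  induction s using Finset.induction_on with
  | empty => simp
  | insert i s _ ih =>
    simp only [Finset.sup_insert]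
    exact (hf i (Finset.mem_insert_self i s)).sup
      (ih fun j hj => hf j (Finset.mem_insert_of_mem hj))

theorem Real.lipschitzWith_one_sin : LipschitzWith 1 Real.sin :=
  lipschitzWith_of_nnnorm_deriv_le Real.differentiable_sin fun x => by
    rw [Real.deriv_sin, ← NNReal.coe_le_coe]
    simpa using Real.abs_cos_le_one x

theorem Real.lipschitzWith_one_cos : LipschitzWith 1 Real.cos :=
  lipschitzWith_of_nnnorm_deriv_le Real.differentiable_cos fun x => by
    rw [Real.deriv_cos, ← NNReal.coe_le_coe]
    simpa using Real.abs_sin_le_one x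

theorem Real.one_le_abs_cos_add_abs_sin (x : ℝ) : 1 ≤ |Real.cos x| + |Real.sin x| := by
  have h := Real.cos_sq_add_sin_sq x
  rw [← sq_abs (Real.cos x), ← sq_abs (Real.sin x)] at h
  nlinarith [abs_nonneg (Real.cos x), abs_nonneg (Real.sin x)]


/-! ### Domination of finitely many derivatives -/

variable {p : ℝ≥0∞} {a b : ℝ} {Γ : ℝ → X}

theorem LIP.mem_of_lipschitzWith {h : X → ℝ} {L : ℝ≥0} (hh : LipschitzWith L h) : h ∈ LIP X :=
  ⟨L, hh⟩

theorem LipACOn.ae_differentiableAt (hab : a ≤ b) (H : LipACOn p a b Γ) {h : X → ℝ}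
    (hh : h ∈ LIP X) : ∀ᵐ t, t ∈ Icc a b → DifferentiableAt ℝ (h ∘ Γ) t := by
  have := (H h hh).1.ae_differentiableAt
  rwa [uIcc_of_le hab] at this

/-- On finitely many compact sets of times with disjoint images, the derivatives along different
Lipschitz functions are dominated by the derivatives along two Lipschitz functions. -/
theorem LipACOn.exists_pair_dominating {ι : Type*} [Finite ι] (hab : a ≤ b) (H : LipACOn p a b Γ)
    (hΓ : ContinuousOn Γ (Icc a b)) {K : ι → Set ℝ} (hK : ∀ i, IsCompact (K i))
    (hKab : ∀ i, K i ⊆ Icc a b) (hd : Pairwise fun i j => Disjoint (Γ '' K i) (Γ '' K j))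
    {h : ι → X → ℝ} (hh : ∀ i, LipschitzWith 1 (h i)) :
    ∃ F₁ F₂ : X → ℝ, LipschitzWith 1 F₁ ∧ LipschitzWith 1 F₂ ∧ ∀ᵐ t, ∀ i, t ∈ K i →
      ‖deriv (h i ∘ Γ) t‖ ≤ ‖deriv (F₁ ∘ Γ) t‖ + ‖deriv (F₂ ∘ Γ) t‖ := by
  obtain ⟨s, hs, hglue⟩ := exists_lipschitzWith_one_glue
    (fun i => (hK i).image_of_continuousOn (hΓ.mono (hKab i))) hd hh
  obtain ⟨F₁, hF₁, h₁⟩ := hglue Real.sin Real.lipschitzWith_one_sin Real.abs_sin_le_one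
  obtain ⟨F₂, hF₂, h₂⟩ := hglue Real.cos Real.lipschitzWith_one_cos Real.abs_cos_le_one
  refine ⟨F₁, F₂, hF₁, hF₂, ?_⟩
  rw [eventually_countable_forall]
  intro i
  have e₁ : EqOn (F₁ ∘ Γ) (fun t => s * Real.sin ((h i ∘ Γ) t / s)) (K i) := fun t ht =>
    h₁ i _ (mem_image_of_mem _ ht)
  have e₂ : EqOn (F₂ ∘ Γ) (fun t => s * Real.cos ((h i ∘ Γ) t / s)) (K i) := fun t ht =>
    h₂ i _ (mem_image_of_mem _ ht)
  filter_upwards [ae_deriv_eq_of_eqOn e₁, ae_deriv_eq_of_eqOn e₂,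
    H.ae_differentiableAt hab (LIP.mem_of_lipschitzWith hF₁),
    H.ae_differentiableAt hab (LIP.mem_of_lipschitzWith hF₂),
    H.ae_differentiableAt hab (LIP.mem_of_lipschitzWith (hh i))] with t d₁ d₂ D₁ D₂ D ht
  have hD := (D (hKab i ht)).hasDerivAt
  have hS := ((hD.div_const s).sin).const_mul s
  have hC := ((hD.div_const s).cos).const_mul s
  rw [d₁ ht (D₁ (hKab i ht)) hS.differentiableAt, d₂ ht (D₂ (hKab i ht)) hC.differentiableAt,
    hS.deriv, hC.deriv]
  have q₁ : s * (Real.cos ((h i ∘ Γ) t / s) * (deriv (h i ∘ Γ) t / s)) =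
      Real.cos ((h i ∘ Γ) t / s) * deriv (h i ∘ Γ) t := by field_simp
  have q₂ : s * (-Real.sin ((h i ∘ Γ) t / s) * (deriv (h i ∘ Γ) t / s)) =
      -(Real.sin ((h i ∘ Γ) t / s) * deriv (h i ∘ Γ) t) := by field_simp
  rw [q₁, q₂, norm_neg, norm_mul, norm_mul, ← add_mul]
  exact le_mul_of_one_le_left (norm_nonneg _) (Real.one_le_abs_cos_add_abs_sin _)

/-- The times at which `h i ∘ Γ` has the first nonzero derivative of maximal modulus. -/
def dominantTimes {Y ι : Type*} [LinearOrder ι] (Γ : ℝ → Y) (h : ι → Y → ℝ) (i : ι) : Set ℝ :=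
  {t | (∀ j, DifferentiableAt ℝ (h j ∘ Γ) t) ∧ deriv (h i ∘ Γ) t ≠ 0 ∧
    (∀ j, ‖deriv (h j ∘ Γ) t‖ ≤ ‖deriv (h i ∘ Γ) t‖) ∧
    ∀ j < i, ‖deriv (h j ∘ Γ) t‖ < ‖deriv (h i ∘ Γ) t‖}

theorem measurableSet_dominantTimes {Y ι : Type*} [LinearOrder ι] [Countable ι] (Γ : ℝ → Y)
    (h : ι → Y → ℝ) (i : ι) : MeasurableSet (dominantTimes Γ h i) := by
  have hm : ∀ j, Measurable fun t => ‖deriv (h j ∘ Γ) t‖ := fun j => (measurable_deriv _).norm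
  refine MeasurableSet.inter ?_ (MeasurableSet.inter ?_ (MeasurableSet.inter ?_ ?_))
  · exact MeasurableSet.congr (MeasurableSet.iInter fun j => measurableSet_of_differentiableAt ℝ (h j ∘ Γ))
      (by ext; simp only [mem_iInter]; rfl)
  · exact (measurableSet_eq_fun (measurable_deriv _) measurable_const).compl
  · exact MeasurableSet.congr (MeasurableSet.iInter fun j => measurableSet_le (hm j) (hm i))
      (by ext; simp only [mem_iInter]; rfl)
  · exact MeasurableSet.congr (MeasurableSet.iInter fun j => MeasurableSet.iInter fun _ : j < i =>
      measurableSet_lt (hm j) (hm i)) (by ext; simp only [mem_iInter]; rfl)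

/-- Let i < j, with t dominant for i, s dominant for j and equal images. The strict inequality in
the tie-break at s gives |h_i'(t) h_j'(s)| > |h_i'(t) h_i'(s)| ≥ |h_j'(t) h_i'(s)|, derivatives
being along `Γ`, so the crossing is transversal. -/
theorem countable_crossing_dominantTimes {Y ι : Type*} [LinearOrder ι] [Countable ι]
    (Γ : ℝ → Y) (h : ι → Y → ℝ) :
    ∃ E : Set ℝ, E.Countable ∧
      Pairwise fun i j =>
        Disjoint (Γ '' (dominantTimes Γ h i \ E)) (Γ '' (dominantTimes Γ h j \ E)) := by
  -- Discarding one of the two times of each crossing is enough.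
  refine ⟨⋃ i, ⋃ j, Prod.fst '' _, countable_iUnion fun i => countable_iUnion fun j =>
    (countable_transversal_pairs (h i ∘ Γ) (h j ∘ Γ)).image _, ?_⟩
  intro i j hij
  wlog hlt : i < j generalizing i j
  · exact (this hij.symm (lt_of_le_of_ne (not_lt.1 hlt) hij.symm)).symm
  rw [Set.disjoint_left]
  rintro _ ⟨t, ⟨ht, htE⟩, rfl⟩ ⟨s, ⟨hs, -⟩, hst⟩
  refine htE (mem_iUnion.2 ⟨i, mem_iUnion.2 ⟨j, (t, s), ?_, rfl⟩⟩)
  refine ⟨by simp [hst], by simp [hst], ht.1 i, hs.1 i, ht.1 j, hs.1 j, fun he => ?_⟩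
  have h1 := ht.2.2.1 j
  have h2 := hs.2.2.2 i hlt
  have h3 : 0 < ‖deriv (h i ∘ Γ) t‖ := norm_pos_iff.2 ht.2.1
  have h4 := congrArg norm he
  rw [norm_mul, norm_mul] at h4
  have h5 := mul_lt_mul_of_pos_left h2 h3
  have h6 := mul_le_mul_of_nonneg_right h1 (norm_nonneg (deriv (h i ∘ Γ) s))
  dsimp only at h4
  linarith

theorem exists_mem_dominantTimes {Y : Type*} {Γ : ℝ → Y} {N : ℕ} {h : Fin N → Y → ℝ}
    {t : ℝ} (hd : ∀ j, DifferentiableAt ℝ (h j ∘ Γ) t) (h0 : ∃ j, deriv (h j ∘ Γ) t ≠ 0) :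
    ∃ i, t ∈ dominantTimes Γ h i := by
  obtain ⟨j, hj⟩ := h0
  have : Nonempty (Fin N) := ⟨j⟩
  obtain ⟨m, hm⟩ := Finite.exists_max fun i => ‖deriv (h i ∘ Γ) t‖
  obtain ⟨i, hi, hmin⟩ := exists_minimal_of_wellFoundedLT
    (fun i => ∀ j, ‖deriv (h j ∘ Γ) t‖ ≤ ‖deriv (h i ∘ Γ) t‖) ⟨m, hm⟩
  refine ⟨i, hd, ?_, hi, ?_⟩
  · rw [← norm_pos_iff]
    exact (norm_pos_iff.2 hj).trans_le (hi j)
  · intro k hk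
    by_contra hle
    exact absurd (hmin (fun l => (hi l).trans (not_lt.1 hle)) hk.le) (not_le.2 hk)

/-- The two terms `C` come from the sine and cosine gluings; the bound does not depend on `N`, which
permits the passage to a sequence. -/
theorem LipACOn.eLpNorm_sup_deriv_le (hp : 1 ≤ p) (hab : a ≤ b) (H : LipACOn p a b Γ)
    (hΓ : ContinuousOn Γ (Icc a b)) {C : ℝ≥0} (hC : ∀ h : X → ℝ, LipschitzWith 1 h →
      eLpNorm (deriv (h ∘ Γ)) p (volume.restrict (Icc a b)) ≤ C)
    {N : ℕ} {h : Fin N → X → ℝ} (hh : ∀ i, LipschitzWith 1 (h i)) :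
    eLpNorm (fun t => ((Finset.univ.sup fun i => ‖deriv (h i ∘ Γ) t‖₊ : ℝ≥0) : ℝ)) p
      (volume.restrict (Icc a b)) ≤ C + C := by
  obtain ⟨E, hE, hdisj⟩ := countable_crossing_dominantTimes Γ h
  set G : ℝ → ℝ := fun t => ((Finset.univ.sup fun i => ‖deriv (h i ∘ Γ) t‖₊ : ℝ≥0) : ℝ) with hGdef
  have hGm : Measurable G := by
    refine Measurable.coe_nnreal_real ?_
    exact measurable_nnreal_finset_sup _ fun i _ => (measurable_deriv _).nnnorm
  have hG0 : ∀ i, ∀ t ∈ dominantTimes Γ h i, G t = ‖deriv (h i ∘ Γ) t‖ := by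
    intro i t ht
    rw [← coe_nnnorm, hGdef, NNReal.coe_inj]
    exact le_antisymm (Finset.sup_le fun j _ => ht.2.2.1 j)
      (Finset.le_sup (f := fun i => ‖deriv (h i ∘ Γ) t‖₊) (Finset.mem_univ i))
  let T : Fin N → Set ℝ := fun i => (dominantTimes Γ h i \ E) ∩ Icc a b
  have hTm : ∀ i, MeasurableSet (T i) := fun i =>
    ((measurableSet_dominantTimes Γ h i).diff hE.measurableSet).inter measurableSet_Icc
  have hTfin : ∀ i, volume (T i) ≠ ⊤ := fun i =>
    ((measure_mono inter_subset_right).trans_lt (isCompact_Icc (a := a) (b := b)).measure_lt_top).ne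
  choose K hKT hKc hKμ using fun (i : Fin N) (n : ℕ) =>
    (hTm i).exists_isCompact_sdiff_lt (hTfin i) (ε := ((n : ℝ≥0∞) + 1)⁻¹)
      (ENNReal.inv_ne_zero.2 (by finiteness))
  -- Accumulating makes the compact sets increase, so the indicators are eventually constant at
  -- almost every time.
  let A : ℕ → Fin N → Set ℝ := fun n i => accumulate (K i) n
  have hAc : ∀ n i, IsCompact (A n i) := fun n i => isCompact_accumulate (hKc i) n
  have hAT : ∀ n i, A n i ⊆ T i := fun n i => iUnion₂_subset fun m _ => hKT i m
  have hAG : ∀ n, eLpNorm ((⋃ i, A n i).indicator G) p (volume.restrict (Icc a b)) ≤ C + C := by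
    intro n
    obtain ⟨F₁, F₂, hF₁, hF₂, hF⟩ := H.exists_pair_dominating hab hΓ (hAc n)
      (fun i => (hAT n i).trans inter_subset_right)
      (fun i j hij => (hdisj hij).mono (image_mono ((hAT n i).trans inter_subset_left))
        (image_mono ((hAT n j).trans inter_subset_left))) hh
    calc eLpNorm ((⋃ i, A n i).indicator G) p (volume.restrict (Icc a b))
        ≤ eLpNorm ((fun t => ‖deriv (F₁ ∘ Γ) t‖) + fun t => ‖deriv (F₂ ∘ Γ) t‖) p
            (volume.restrict (Icc a b)) := by
          refine eLpNorm_mono_ae_real (ae_restrict_of_ae ?_)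
          filter_upwards [hF] with t ht
          by_cases htA : t ∈ ⋃ i, A n i
          · obtain ⟨i, hi⟩ := mem_iUnion.1 htA
            rw [indicator_of_mem htA, hG0 i t (hAT n i hi).1.1, norm_norm]
            exact ht i hi
          · rw [indicator_of_notMem htA, norm_zero]
            exact add_nonneg (norm_nonneg _) (norm_nonneg _)
      _ ≤ eLpNorm (fun t => ‖deriv (F₁ ∘ Γ) t‖) p (volume.restrict (Icc a b)) +
            eLpNorm (fun t => ‖deriv (F₂ ∘ Γ) t‖) p (volume.restrict (Icc a b)) :=
          eLpNorm_add_le (measurable_deriv _).norm.aestronglyMeasurable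
            (measurable_deriv _).norm.aestronglyMeasurable hp
      _ ≤ C + C := by
          rw [eLpNorm_norm, eLpNorm_norm]
          exact add_le_add (hC _ hF₁) (hC _ hF₂)
  have hrest : ∀ i, volume (T i \ ⋃ n, K i n) = 0 := by
    intro i
    refine le_antisymm (ge_of_tendsto' (x := atTop) (f := fun n : ℕ => ((n : ℝ≥0∞) + 1)⁻¹) ?_
      fun n => ?_) zero_le
    · exact_mod_cast (tendsto_add_atTop_iff_nat 1).2 ENNReal.tendsto_inv_nat_nhds_zero
    · exact (measure_mono (sdiff_subset_sdiff_right (subset_iUnion _ n))).trans (hKμ i n).le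
  have hlim : ∀ᵐ t ∂(volume.restrict (Icc a b)),
      Tendsto (fun n => (⋃ i, A n i).indicator G t) atTop (𝓝 (G t)) := by
    rw [ae_restrict_iff' measurableSet_Icc]
    have hdiff : ∀ᵐ t, ∀ i, t ∈ Icc a b → DifferentiableAt ℝ (h i ∘ Γ) t :=
      eventually_countable_forall.2 fun i =>
        H.ae_differentiableAt hab (LIP.mem_of_lipschitzWith (hh i))
    have hnull : ∀ᵐ t, ∀ i, t ∉ T i \ ⋃ n, K i n :=
      eventually_countable_forall.2 fun i => measure_eq_zero_iff_ae_notMem.1 (hrest i)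
    filter_upwards [hdiff, hnull, measure_eq_zero_iff_ae_notMem.1 (hE.measure_zero volume)]
      with t h1 h2 h3 ht
    by_cases h0 : ∃ j, deriv (h j ∘ Γ) t ≠ 0
    · obtain ⟨i, hi⟩ := exists_mem_dominantTimes (fun j => h1 j ht) h0
      have hK : t ∈ ⋃ n, K i n := by
        by_contra hn
        exact h2 i ⟨⟨⟨hi, h3⟩, ht⟩, hn⟩
      obtain ⟨m, hm⟩ := mem_iUnion.1 hK
      refine tendsto_const_nhds.congr' ?_
      filter_upwards [eventually_ge_atTop m] with n hn
      rw [indicator_of_mem]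
      exact mem_iUnion.2 ⟨i, mem_accumulate.2 ⟨m, hn, hm⟩⟩
    · push Not at h0
      have : G t = 0 := by simp [hGdef, h0]
      simp [indicator, this]
  refine (Lp.eLpNorm_lim_le_liminf_eLpNorm (fun n => ?_) G hlim).trans ?_
  · exact (hGm.indicator (MeasurableSet.iUnion fun i => (hAc n i).measurableSet)).aestronglyMeasurable
  · exact (liminf_le_liminf (Eventually.of_forall hAG)).trans_eq (liminf_const _)

/-! ### The L_p majorant and the two implications -/

theorem LipACOn.continuousOn (hab : a ≤ b) (H : LipACOn p a b Γ) : ContinuousOn Γ (Icc a b) := by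
  intro t ht
  rw [ContinuousWithinAt, tendsto_iff_dist_tendsto_zero]
  have h1 := (H (fun x => dist x (Γ t))
    (LIP.mem_of_lipschitzWith (LipschitzWith.dist_left (Γ t)))).1.continuousOn
  rw [uIcc_of_le hab] at h1
  simpa [Function.comp_def] using (h1 t ht).tendsto

/-- The suprema of derivatives along a sequence of Lipschitz functions lie in `L_p`. -/
theorem LipACOn.exists_dominating (hp : 1 ≤ p) (hab : a ≤ b) (H : LipACOn p a b Γ)
    {h : ℕ → X → ℝ} (hh : ∀ i, LipschitzWith 1 (h i)) :
    ∃ g : ℝ → ℝ, Measurable g ∧ (∀ t, 0 ≤ g t) ∧ MemLp g p (volume.restrict (Icc a b)) ∧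
      ∀ᵐ t ∂(volume.restrict (Icc a b)), ∀ n, ‖deriv (h n ∘ Γ) t‖ ≤ g t := by
  obtain ⟨C, hC⟩ := H.exists_eLpNorm_le hp hab
  let G : ℕ → ℝ → ℝ≥0 := fun N t => Finset.univ.sup fun i : Fin N => ‖deriv (h i ∘ Γ) t‖₊
  have hGm : ∀ N, Measurable (G N) := fun N =>
    measurable_nnreal_finset_sup _ fun i _ => (measurable_deriv _).nnnorm
  have hle : ∀ N, eLpNorm (fun t => (G N t : ℝ)) p (volume.restrict (Icc a b)) ≤ C + C := fun N =>
    H.eLpNorm_sup_deriv_le hp hab (H.continuousOn hab) hC (fun i : Fin N => hh i)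
  have hmono : ∀ t, Monotone fun N => G N t := by
    intro t M N hMN
    refine Finset.sup_le fun i _ => ?_
    exact Finset.le_sup (f := fun i : Fin N => ‖deriv (h i ∘ Γ) t‖₊)
      (Finset.mem_univ (Fin.castLE hMN i))
  have hnG : ∀ n t, ‖deriv (h n ∘ Γ) t‖₊ ≤ G (n + 1) t := fun n t =>
    Finset.le_sup (f := fun i : Fin (n + 1) => ‖deriv (h i ∘ Γ) t‖₊) (Finset.mem_univ (Fin.last n))
  -- The supremum may be infinite on a null set, where `toReal` gives 0; hence domination holds only
  -- almost everywhere.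
  let M : ℝ → ℝ≥0∞ := fun t => ⨆ N, (G N t : ℝ≥0∞)
  have hMm : Measurable M := Measurable.iSup fun N => (hGm N).coe_nnreal_ennreal
  have hMfin : ∀ᵐ t ∂(volume.restrict (Icc a b)), M t < ⊤ := by
    refine ae_lt_top hMm ?_
    obtain ⟨D, hD⟩ := exists_eLpNorm_one_le (volume.restrict (Icc a b)) hp
    have h1 : ∫⁻ t in Icc a b, M t ≤ (C + C) * D := by
      rw [lintegral_iSup (fun N => (hGm N).coe_nnreal_ennreal)
        (fun m n hmn t => ENNReal.coe_le_coe.2 (hmono t hmn))]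
      refine iSup_le fun N => ?_
      have h2 := (hD (fun t => (G N t : ℝ)) (hGm N).coe_nnreal_real.aestronglyMeasurable).trans
        (mul_le_mul_left (hle N) _)
      rw [eLpNorm_one_eq_lintegral_enorm] at h2
      simpa using h2
    exact ne_top_of_le_ne_top (by finiteness) h1
  have hlim : ∀ᵐ t ∂(volume.restrict (Icc a b)),
      Tendsto (fun N => (G N t : ℝ)) atTop (𝓝 (M t).toReal) := by
    filter_upwards [hMfin] with t ht
    have h1 : Tendsto (fun N => (G N t : ℝ≥0∞)) atTop (𝓝 (M t)) :=
      tendsto_atTop_iSup fun m n hmn => ENNReal.coe_le_coe.2 (hmono t hmn)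
    exact (ENNReal.tendsto_toReal ht.ne).comp h1
  refine ⟨fun t => (M t).toReal, hMm.ennreal_toReal, fun t => ENNReal.toReal_nonneg,
    ⟨hMm.ennreal_toReal.aestronglyMeasurable, ?_⟩, ?_⟩
  · refine ((Lp.eLpNorm_lim_le_liminf_eLpNorm
      (fun N => (hGm N).coe_nnreal_real.aestronglyMeasurable) _ hlim).trans
      ((liminf_le_liminf (Eventually.of_forall hle)).trans_eq (liminf_const _))).trans_lt ?_
    finiteness
  · filter_upwards [hMfin] with t ht n
    have h1 : (‖deriv (h n ∘ Γ) t‖₊ : ℝ≥0∞) ≤ M t :=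
      (ENNReal.coe_le_coe.2 (hnG n t)).trans (le_iSup (fun N => (G N t : ℝ≥0∞)) (n + 1))
    simpa using ENNReal.toReal_mono ht.ne h1

theorem AC.comp_lipschitzWith {f : Icc a b → X} (hf : f ∈ AC p a b X) {h : X → ℝ} (hh : h ∈ LIP X) :
    h ∘ f ∈ AC p a b ℝ := by
  obtain ⟨L, hL⟩ := hh
  obtain ⟨g, hgm, hg0, hgp, hfg⟩ := hf
  refine ⟨fun t => L * g t, hgm.const_mul _, fun t ht => mul_nonneg L.coe_nonneg (hg0 t ht),
    hgp.const_mul _, fun t₁ t₂ h12 => ?_⟩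
  rw [intervalIntegral.integral_const_mul]
  exact (hL.dist_le_mul _ _).trans (mul_le_mul_of_nonneg_left (hfg t₁ t₂ h12) L.coe_nonneg)

theorem AC.of_forall_comp (hp : 1 ≤ p) (hab : a ≤ b) {γ : Icc a b → X}
    (hγ : ∀ h ∈ LIP X, h ∘ γ ∈ AC p a b ℝ) : γ ∈ AC p a b X := by
  have H : LipACOn p a b (IccExtend hab γ) := fun h hh =>
    by simpa only [IccExtend, ← Function.comp_assoc] using
      AC.absolutelyContinuousOnInterval_and_memLp_deriv hp hab (hγ h hh)
  have hΓ : ∀ t : Icc a b, IccExtend hab γ t = γ t := fun t => IccExtend_val hab γ t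
  have hγc : Continuous γ := by
    have := (H.continuousOn hab).comp_continuous continuous_subtype_val fun t => t.2
    simpa only [Function.comp_def, hΓ] using this
  have : Nonempty (Icc a b) := ⟨⟨a, left_mem_Icc.2 hab⟩⟩
  let x : ℕ → X := fun n => γ (TopologicalSpace.denseSeq (Icc a b) n)
  have hh : ∀ n, LipschitzWith 1 fun y => dist y (x n) := fun n => LipschitzWith.dist_left _
  obtain ⟨g, hgm, hg0, hgp, hg⟩ := H.exists_dominating hp hab hh
  refine ⟨g, hgm, fun t _ => hg0 t, hgp, fun t₁ t₂ h12 => ?_⟩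
  have hsub : Ioc (t₁ : ℝ) t₂ ⊆ Icc a b := fun s hs =>
    ⟨t₁.2.1.trans hs.1.le, hs.2.trans t₂.2.2⟩
  have key : ∀ n, |dist (γ t₂) (x n) - dist (γ t₁) (x n)| ≤ ∫ t in (t₁ : ℝ)..t₂, g t := by
    intro n
    have h1 := ((H _ (LIP.mem_of_lipschitzWith (hh n))).1.mono (c := t₁) (d := t₂) (by
      rw [uIcc_of_le hab]; exact uIcc_subset_Icc t₁.2 t₂.2)).integral_deriv_eq_sub
    simp only [Function.comp_apply, hΓ] at h1
    rw [← h1, ← Real.norm_eq_abs]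
    refine intervalIntegral.norm_integral_le_of_norm_le h12 ?_ ?_
    · rw [ae_restrict_iff' measurableSet_Icc] at hg
      filter_upwards [hg] with t ht hts using ht (hsub hts) n
    · rw [intervalIntegrable_iff_integrableOn_Ioc_of_le h12]
      exact IntegrableOn.mono_set (t := Icc a b) (hgp.integrable hp) hsub
  -- Density of the chosen times and continuity of `γ` extend the bound to every τ; taking τ = `t₂`
  -- leaves the distance of the endpoints.
  have hall : ∀ τ, |dist (γ t₂) (γ τ) - dist (γ t₁) (γ τ)| ≤ ∫ t in (t₁ : ℝ)..t₂, g t := fun τ =>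
    (TopologicalSpace.denseRange_denseSeq (Icc a b)).induction_on τ
      (isClosed_le (by fun_prop) continuous_const) key
  simpa using hall t₂

end

theorem theorem1p1 {X : Type*} [MetricSpace X] (p : ℝ≥0∞) (hp : 1 ≤ p) (a b : ℝ) (hab : a ≤ b)
    (γ : Set.Icc a b → X) :
    γ ∈ AC p a b X ↔ ∀ h ∈ LIP X, h ∘ γ ∈ AC p a b ℝ :=
  ⟨fun hγ _ hh => AC.comp_lipschitzWith hγ hh, AC.of_forall_comp hp hab⟩
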